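/- Let $\mathcal H$ be a complex Hilbert space. A (normalized, real) POVM is a map $F$ from the Borel sets $\mathcal B(\mathbb R)$ to the positive bounded operators on $\mathcal H$ with $F(\mathbb R)=\mathbf 1$ and $F(\bigcup_{n}\Delta_n)=\sum_{n}F(\Delta_n)$ in the weak operator topology for every sequence of pairwise disjoint Borel sets $\Delta_n$; it is commutative if $F(\Delta_1)F(\Delta_2)=F(\Delta_2)F(\Delta_1)$ for all Borel $\Delta_1,\Delta_2$. It is uniformly continuous if $\lim_{n\to\infty}\big\|\sum_{i=1}^{n}F(\Delta_i)-F(\bigcup_{i=1}^\infty\Delta_i)\big\|=0$ for every sequence of pairwise disjoint Borel sets $\Delta_i$. A sharp version of $F$ is a bounded self-adjoint operator $A=\int\lambda\,dE_\lambda$, with spectrum contained in $[0,1]$ and spectral measure $E$, such that $A$ and $\{F(\Delta):\Delta\in\mathcal B(\mathbb R)\}$ generate the same von Neumann algebra. A strong Feller Markov kernel is a map $\mu:[0,1]\times\mathcal B(\mathbb R)\to[0,1]$, $(\lambda,\Delta)\mapsto\mu_\Delta(\lambda)$, such that $\mu_{(\cdot)}(\lambda)$ is a probability measure for each $\lambda\in[0,1]$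 and $\mu_\Delta$ is continuous on $[0,1]$ for each $\Delta\in\mathcal B(\mathbb R)$. We say that $F$ admits a strong Feller Markov kernel if there exist a sharp version $A$ of $F$, with spectral measure $E$, and a strong Feller Markov kernel $\mu$ such that $F(\Delta)=\int\mu_\Delta(\lambda)\,dE_\lambda$ for every $\Delta\in\mathcal B(\mathbb R)$. **Theorem.** A commutative POVM $F:\mathcal B(\mathbb R)\to\mathcal B(\mathcal H)$ admits a strong Feller Markov kernel if and only if it is uniformly continuous. -/

import Mathlib

open MeasureTheory ProbabilityTheory Filter Topology

/-- A normalized semispectral measure (positive operator valued measure) on a measurable space `X`,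
acting in the Hilbert space `H`: a map from the measurable sets to the positive bounded operators,
`σ`-additive in the weak operator topology and of total mass `1`.
The values on non-measurable sets carry no meaning and are never used. -/
structure POVM (X : Type*) [MeasurableSpace X] (H : Type*) [NormedAddCommGroup H]
    [InnerProductSpace ℂ H] [CompleteSpace H] where
  /-- the operator attached to a set -/
  op : Set X → (H →L[ℂ] H)
  isPositive : ∀ Δ, MeasurableSet Δ → (op Δ).IsPositive
  weak_sigma_additive : ∀ Δ : ℕ → Set X, (∀ i, MeasurableSet (Δ i)) →
    Pairwise (Function.onFun Disjoint Δ) →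
    ∀ x y : H, HasSum (fun i => inner ℂ x (op (Δ i) y)) (inner ℂ x (op (⋃ i, Δ i) y))
  normalized : op Set.univ = 1

/-- The von Neumann algebra generated by a set `S` of bounded operators: the double commutant of
`S ∪ star S` (`StarSubalgebra.centralizer ℂ S` is the commutant of `S ∪ star S`). -/
noncomputable def vonNeumannGenerated {H : Type*} [NormedAddCommGroup H] [InnerProductSpace ℂ H]
    [CompleteSpace H] (S : Set (H →L[ℂ] H)) : VonNeumannAlgebra H where
  toStarSubalgebra :=
    StarSubalgebra.centralizer ℂ (StarSubalgebra.centralizer ℂ S : Set (H →L[ℂ] H))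
  centralizer_centralizer' := by
    have h : ∀ M : StarSubalgebra ℂ (H →L[ℂ] H),
        (StarSubalgebra.centralizer ℂ (M : Set (H →L[ℂ] H)) : Set (H →L[ℂ] H))
          = Set.centralizer (M : Set (H →L[ℂ] H)) := by
      intro M
      rw [StarSubalgebra.coe_centralizer]
      congr 1
      apply Set.union_eq_left.mpr
      intro a ha
      simpa using star_mem (s := M) (Set.mem_star.mp ha)
    change Set.centralizer (Set.centralizer
      (StarSubalgebra.centralizer ℂ (StarSubalgebra.centralizer ℂ S : Set (H →L[ℂ] H)) :
        Set (H →L[ℂ] H))) = _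
    rw [h]
    exact (Set.centralizer_centralizer_centralizer
      (StarSubalgebra.centralizer ℂ S : Set (H →L[ℂ] H))).trans (h _).symm

/-- The generated von Neumann algebra is the smallest one that contains the set. -/
theorem vonNeumannGenerated_le_iff {H : Type*} [NormedAddCommGroup H] [InnerProductSpace ℂ H]
    [CompleteSpace H] (S : Set (H →L[ℂ] H)) (M : VonNeumannAlgebra H) :
    vonNeumannGenerated S ≤ M ↔ S ⊆ (M : Set (H →L[ℂ] H)) := by
  have hmem : ∀ a, a ∈ vonNeumannGenerated S ↔
      a ∈ StarSubalgebra.centralizer ℂ (StarSubalgebra.centralizer ℂ S : Set (H →L[ℂ] H)) :=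
    fun a => Iff.rfl
  constructor
  · intro h a ha
    refine h ((hmem a).2 ?_)
    rw [StarSubalgebra.mem_centralizer_iff]
    intro g hg
    have hg' := (StarSubalgebra.mem_centralizer_iff ℂ).1 hg a ha
    refine ⟨hg'.1.symm, ?_⟩
    have := congrArg star hg'.2
    simp only [star_mul, star_star] at this
    exact this
  · intro h a ha
    have ha' := (StarSubalgebra.mem_centralizer_iff ℂ).1 ((hmem a).1 ha)
    rw [← VonNeumannAlgebra.commutant_commutant M, VonNeumannAlgebra.mem_commutant_iff]
    intro g hg
    refine (ha' g ?_).1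
    refine (StarSubalgebra.mem_centralizer_iff ℂ).2 fun s hs => ?_
    have h1 := VonNeumannAlgebra.mem_commutant_iff.1 hg
    exact ⟨h1 s (h hs), h1 (star s) (star_mem (h hs))⟩

namespace POVM

variable {X : Type*} [MeasurableSpace X] {H : Type*} [NormedAddCommGroup H]
    [InnerProductSpace ℂ H] [CompleteSpace H]

theorem op_empty_inner (F : POVM X H) (x : H) : inner ℂ x (F.op ∅ x) = 0 := by
  have h := F.weak_sigma_additive (fun _ => ∅) (fun _ => MeasurableSet.empty)
    (fun _ _ _ => by simp [Function.onFun]) x x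
  exact tendsto_nhds_unique tendsto_const_nhds h.summable.tendsto_atTop_zero

/-- The finite positive measure `Δ ↦ ⟨F(Δ) x, x⟩`. -/
noncomputable def scalarMeasure (F : POVM X H) (x : H) : Measure X :=
  Measure.ofMeasurable (fun Δ _ => ENNReal.ofReal (RCLike.re (inner ℂ x (F.op Δ x))))
    (by simp [F.op_empty_inner x])
    (by
      intro Δ hΔ hd
      have h := (F.weak_sigma_additive Δ hΔ hd x x).mapL (RCLike.reCLM (K := ℂ))
      simp only [RCLike.reCLM_apply] at h
      rw [← h.tsum_eq]
      exact ENNReal.ofReal_tsum_of_nonneg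
        (fun i => (F.isPositive _ (hΔ i)).re_inner_nonneg_right x) h.summable)

theorem scalarMeasure_apply (F : POVM X H) (x : H) {Δ : Set X} (hΔ : MeasurableSet Δ) :
    F.scalarMeasure x Δ = ENNReal.ofReal (RCLike.re (inner ℂ x (F.op Δ x))) :=
  Measure.ofMeasurable_apply Δ hΔ

/-- `B = ∫ f dF` for a bounded measurable function `f`, i.e. `⟨B x, x⟩ = ∫ f d⟨F(·) x, x⟩` for
all vectors `x`. -/
def IsIntegral (F : POVM X H) (f : X → ℝ) (B : H →L[ℂ] H) : Prop :=
  ∀ x : H, inner ℂ (B x) x = ((∫ t, f t ∂(F.scalarMeasure x) : ℝ) : ℂ)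

/-- Commutativity: `[F(Δ₁), F(Δ₂)] = 0`. -/
def IsCommutative (F : POVM X H) : Prop :=
  ∀ Δ₁ Δ₂ : Set X, MeasurableSet Δ₁ → MeasurableSet Δ₂ → Commute (F.op Δ₁) (F.op Δ₂)

/-- A spectral measure (PVM) is an orthogonal normalized POVM. -/
def IsPVM (E : POVM X H) : Prop :=
  ∀ Δ₁ Δ₂ : Set X, MeasurableSet Δ₁ → MeasurableSet Δ₂ → Disjoint Δ₁ Δ₂ →
    E.op Δ₁ * E.op Δ₂ = 0

/-- Uniform continuity: `σ`-additivity in the operator norm. -/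
def IsUniformlyContinuous (F : POVM X H) : Prop :=
  ∀ Δ : ℕ → Set X, (∀ i, MeasurableSet (Δ i)) → Pairwise (Function.onFun Disjoint Δ) →
    Tendsto (fun n => ∑ i ∈ Finset.range n, F.op (Δ i)) atTop (𝓝 (F.op (⋃ i, Δ i)))

/-- The von Neumann algebra generated by `F`. -/
noncomputable def vonNeumann (F : POVM X H) : VonNeumannAlgebra H :=
  vonNeumannGenerated {B | ∃ Δ, MeasurableSet Δ ∧ F.op Δ = B}

/-- `A` is a sharp version of `F` with spectral measure `E` living on `[0, 1]`: `A = ∫ λ dE_λ` is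
the bounded self-adjoint operator that corresponds to the spectral measure `E`, and `A` and `F`
generate the same von Neumann algebra. -/
structure IsSharpVersion (F : POVM ℝ H) (A : H →L[ℂ] H) (E : POVM (Set.Icc (0 : ℝ) 1) H) :
    Prop where
  isSelfAdjoint : IsSelfAdjoint A
  isPVM : E.IsPVM
  isIntegral : E.IsIntegral (fun t => (t : ℝ)) A
  generates : vonNeumannGenerated {A} = F.vonNeumann

end POVM

/-- A Markov kernel `μ : [0, 1] × 𝓑(ℝ) → [0, 1]` is strong Feller if `λ ↦ μ_Δ(λ)` is continuous
for every Borel set `Δ`. -/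
def IsStrongFeller (μ : Kernel (Set.Icc (0 : ℝ) 1) ℝ) : Prop :=
  ∀ Δ : Set ℝ, MeasurableSet Δ → Continuous fun t => (μ t).real Δ

/-- `F` admits a strong Feller Markov kernel: `F(Δ) = ∫ μ_Δ(λ) dE_λ` for every Borel set `Δ`, with
a strong Feller Markov kernel `μ` and the spectral measure `E` of a sharp version of `F`. -/
def POVM.AdmitsStrongFellerKernel {H : Type*} [NormedAddCommGroup H] [InnerProductSpace ℂ H]
    [CompleteSpace H] (F : POVM ℝ H) : Prop :=
  ∃ (A : H →L[ℂ] H) (E : POVM (Set.Icc (0 : ℝ) 1) H) (μ : Kernel (Set.Icc (0 : ℝ) 1) ℝ),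
    F.IsSharpVersion A E ∧ IsMarkovKernel μ ∧ IsStrongFeller μ ∧
      ∀ Δ : Set ℝ, MeasurableSet Δ → E.IsIntegral (fun t => (μ t).real Δ) (F.op Δ)

/-! If `F = ∫ μ dE` with `μ` strong Feller, then for disjoint `Δᵢ` the continuous functions
`t ↦ μ_t(⋃_{i ≥ n} Δᵢ)` decrease to `0`, uniformly by Dini's theorem, and `‖∫ f dE‖ ≤ sup f` for
`f ≥ 0` makes `F` norm `σ`-additive.

Conversely, the self-adjoint part of the commutative von Neumann algebra of `F` is a copy of
`C(Y, ℝ)` with `Y` compact and totally disconnected. As the isometry `ψ : C(Y, ℝ) → B(H)` respects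
norm limits, norm `σ`-additivity makes `Δ ↦ ψ⁻¹(F(Δ))(y)` a genuine probability measure `M_y` for
every `y ∈ Y`. Countably many `Δ` determine `M_y`, so a coding through the Cantor set provides a
continuous `a : Y → [0, 1]` such that `M_y` depends only on `a(y)`. The measures thus live on the
compact set `a(Y)`, and averaging them over a random retraction of `[0, 1]` onto `a(Y)` extends them
to a strong Feller kernel on `[0, 1]`. The sharp version is `A = ψ(a)`. -/

section Operators

variable {H : Type*} [NormedAddCommGroup H] [InnerProductSpace ℂ H]

theorem inner_apply_self_eq_ofReal_iff {T : H →L[ℂ] H} {x : H} {r : ℝ} :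
    inner ℂ (T x) x = (r : ℂ) ↔ inner ℂ x (T x) = (r : ℂ) := by
  rw [← inner_conj_symm x (T x), ← (starRingEnd ℂ).injective.eq_iff, Complex.conj_ofReal]

theorem ext_inner_apply_self {S T : H →L[ℂ] H}
    (h : ∀ x, inner ℂ x (S x) = inner ℂ x (T x)) : S = T :=
  ContinuousLinearMap.coe_injective <| (ext_inner_map (S : H →ₗ[ℂ] H) (T : H →ₗ[ℂ] H)).1 fun x =>
    (starRingEnd ℂ).injective <| by simpa only [inner_conj_symm] using! h x

theorem inner_polarization (T : H →L[ℂ] H) (x y : H) :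
    inner ℂ x (T y) = (inner ℂ (x + y) (T (x + y)) - inner ℂ (x - y) (T (x - y)) -
      Complex.I * inner ℂ (x + Complex.I • y) (T (x + Complex.I • y)) +
      Complex.I * inner ℂ (x - Complex.I • y) (T (x - Complex.I • y))) / 4 := by
  simp only [map_add, map_sub, map_smul, inner_add_left, inner_add_right, inner_sub_left,
    inner_sub_right, inner_smul_left, inner_smul_right, Complex.conj_I]
  linear_combination (inner ℂ x (T y)) / 2 * (Complex.I_sq) -
    (inner ℂ y (T x)) / 2 * (Complex.I_sq)

theorem hasSum_inner_apply {ι : Type*} {T : ι → H →L[ℂ] H}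
    {S : H →L[ℂ] H} (h : ∀ x, HasSum (fun i => inner ℂ x (T i x)) (inner ℂ x (S x)))
    (x y : H) : HasSum (fun i => inner ℂ x (T i y)) (inner ℂ x (S y)) := by
  rw [inner_polarization S x y]
  simp_rw [fun i => inner_polarization (T i) x y]
  exact (((((h _).sub (h _)).sub ((h _).mul_left _)).add ((h _).mul_left _)).div_const _)

theorem isPositive_of_inner_eq {T : H →L[ℂ] H} {q : H → ℝ} (hq : ∀ x, 0 ≤ q x)
    (h : ∀ x, inner ℂ x (T x) = (q x : ℂ)) : T.IsPositive := by
  rw [ContinuousLinearMap.isPositive_iff_complex]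
  intro x
  rw [inner_apply_self_eq_ofReal_iff.2 (h x)]
  simpa using hq x

variable [CompleteSpace H]

theorem norm_le_of_inner_eq {T : H →L[ℂ] H} {q : H → ℝ} {c : ℝ} (hc : 0 ≤ c)
    (hq : ∀ x, 0 ≤ q x) (hqc : ∀ x, q x ≤ c * ‖x‖ ^ 2)
    (h : ∀ x, inner ℂ x (T x) = (q x : ℂ)) : ‖T‖ ≤ c := by
  have hT : 0 ≤ T := (ContinuousLinearMap.nonneg_iff_isPositive T).2 (isPositive_of_inner_eq hq h)
  rw [CStarAlgebra.norm_le_iff_le_algebraMap T hc hT, ContinuousLinearMap.le_def]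
  refine isPositive_of_inner_eq (q := fun x => c * ‖x‖ ^ 2 - q x)
    (fun x => sub_nonneg.2 (hqc x)) fun x => ?_
  have hcx : (algebraMap ℝ (H →L[ℂ] H) c) x = (c : ℂ) • x := by
    simp [Algebra.algebraMap_eq_smul_one]
  rw [sub_apply, inner_sub_right, h x, hcx, inner_smul_right, inner_self_eq_norm_sq_to_K]
  push_cast
  rfl

end Operators

section FiniteMeasure

variable {X : Type*} [MeasurableSpace X]

theorem hasSum_measureReal_iUnion {μ : Measure X} [IsFiniteMeasure μ] {Δ : ℕ → Set X}
    (hΔ : ∀ i, MeasurableSet (Δ i)) (hd : Pairwise (Function.onFun Disjoint Δ)) :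
    HasSum (fun i => μ.real (Δ i)) (μ.real (⋃ i, Δ i)) := by
  have h := measure_iUnion (μ := μ) hd hΔ
  rw [measureReal_def, h, ENNReal.tsum_toReal_eq fun i => measure_ne_top _ _]
  exact ENNReal.hasSum_toReal (h ▸ measure_ne_top _ _)

open RealInnerProductSpace in
theorem inner_toLp [TopologicalSpace X] [CompactSpace X] [BorelSpace X] (μ : Measure X)
    [IsFiniteMeasure μ] (f g : C(X, ℝ)) :
    ⟪ContinuousMap.toLp 2 μ ℝ f, ContinuousMap.toLp 2 μ ℝ g⟫ = ∫ t, f t * g t ∂μ := by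
  simp only [ContinuousMap.inner_toLp, RCLike.conj_to_real, mul_comm]

end FiniteMeasure

section SpectralMeasure

open CompactlySupported RealInnerProductSpace

variable {X : Type*} [TopologicalSpace X] {H : Type*} [NormedAddCommGroup H]
  [InnerProductSpace ℂ H] [CompleteSpace H]

theorem isSelfAdjoint_starAlgHom_apply (φ : C(X, ℝ) →⋆ₐ[ℝ] (H →L[ℂ] H)) (f : C(X, ℝ)) :
    IsSelfAdjoint (φ f) :=
  (IsSelfAdjoint.all f).map φ

theorem isPositive_starAlgHom_apply (φ : C(X, ℝ) →⋆ₐ[ℝ] (H →L[ℂ] H)) {f : C(X, ℝ)}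
    (hf : 0 ≤ f) : (φ f).IsPositive :=
  (ContinuousLinearMap.nonneg_iff_isPositive _).1 (map_nonneg φ hf)

/-- The positive functional `f ↦ ⟨x, φ(f) x⟩`, on compactly supported functions as the
Riesz–Markov–Kakutani theorem wants it. -/
noncomputable def quadraticFormFunctional (φ : C(X, ℝ) →⋆ₐ[ℝ] (H →L[ℂ] H)) (x : H) :
    C_c(X, ℝ) →ₚ[ℝ] ℝ :=
  PositiveLinearMap.mk₀
    { toFun := fun f => (inner ℂ x (φ f.toContinuousMap x)).re
      map_add' := fun f g => by
        have : (f + g).toContinuousMap = f.toContinuousMap + g.toContinuousMap := rfl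
        rw [this, map_add, add_apply, inner_add_right, Complex.add_re]
      map_smul' := fun c f => by
        have : (c • f).toContinuousMap = c • f.toContinuousMap := rfl
        rw [this, map_smul, _root_.smul_apply, inner_smul_right_eq_smul]
        simp }
    fun _ hf => (isPositive_starAlgHom_apply φ hf).re_inner_nonneg_right x

variable [CompactSpace X] [T2Space X] [MeasurableSpace X] [BorelSpace X]

/-- The spectral measure of the vector `x`: the Riesz measure of `f ↦ ⟨x, φ(f) x⟩`. -/
noncomputable def vectorMeasure (φ : C(X, ℝ) →⋆ₐ[ℝ] (H →L[ℂ] H)) (x : H) : Measure X :=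
  RealRMK.rieszMeasure (quadraticFormFunctional φ x)

variable (φ : C(X, ℝ) →⋆ₐ[ℝ] (H →L[ℂ] H))

instance (x : H) : (vectorMeasure φ x).InnerRegular := by
  unfold vectorMeasure
  infer_instance

instance (x : H) : IsFiniteMeasure (vectorMeasure φ x) := by
  unfold vectorMeasure
  infer_instance

theorem inner_starAlgHom_apply_self (x : H) (f : C(X, ℝ)) :
    inner ℂ x (φ f x) = ((∫ t, f t ∂vectorMeasure φ x : ℝ) : ℂ) := by
  refine ((isSelfAdjoint_starAlgHom_apply φ f).isSymmetric.coe_re_inner_self_apply x).symm.trans ?_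
  exact congrArg _ (RealRMK.integral_rieszMeasure (quadraticFormFunctional φ x)
    (CompactlySupportedContinuousMap.continuousMapEquiv f)).symm

theorem inner_starAlgHom_apply_starAlgHom_apply (x : H) (f g : C(X, ℝ)) :
    inner ℂ (φ f x) (φ g x) = ((∫ t, f t * g t ∂vectorMeasure φ x : ℝ) : ℂ) := by
  rw [← ContinuousLinearMap.adjoint_inner_right,
    ContinuousLinearMap.isSelfAdjoint_iff'.1 (isSelfAdjoint_starAlgHom_apply φ f),
    ← mul_apply_eq_comp, ← map_mul, inner_starAlgHom_apply_self]
  rfl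

/-- The map `f ↦ φ(f) x` onto a dense subspace of the real cyclic subspace of `x`. -/
noncomputable def orbitMap (x : H) : C(X, ℝ) →ₗ[ℝ] H where
  toFun f := φ f x
  map_add' f g := by rw [map_add, add_apply]
  map_smul' c f := by rw [map_smul, _root_.smul_apply, RingHom.id_apply]

/-- The isometry of `L²` of the spectral measure of `x` into `H` that extends `f ↦ φ(f) x`. -/
noncomputable def cyclicMap (x : H) : Lp ℝ 2 (vectorMeasure φ x) →L[ℝ] H :=
  LinearMap.extendOfNorm (orbitMap φ x) (ContinuousMap.toLp 2 (vectorMeasure φ x) ℝ).toLinearMap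

theorem norm_starAlgHom_apply (x : H) (f : C(X, ℝ)) :
    ‖φ f x‖ = ‖ContinuousMap.toLp 2 (vectorMeasure φ x) ℝ f‖ := by
  have h := inner_starAlgHom_apply_starAlgHom_apply φ x f f
  rw [inner_self_eq_norm_sq_to_K, ← inner_toLp, real_inner_self_eq_norm_sq] at h
  exact (sq_eq_sq₀ (norm_nonneg _) (norm_nonneg _)).1 (Complex.ofReal_injective (by simpa using h))

theorem cyclicMap_toLp (x : H) (f : C(X, ℝ)) :
    cyclicMap φ x (ContinuousMap.toLp 2 _ ℝ f) = φ f x :=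
  LinearMap.extendOfNorm_eq (f := orbitMap φ x)
    (e := (ContinuousMap.toLp 2 (vectorMeasure φ x) ℝ).toLinearMap)
    (ContinuousMap.toLp_denseRange ℝ _ ℝ (by simp))
    ⟨1, fun f => (one_mul (_ : ℝ)).symm ▸ (norm_starAlgHom_apply φ x f).le⟩ f

theorem inner_cyclicMap (x : H) (a b : Lp ℝ 2 (vectorMeasure φ x)) :
    inner ℂ (cyclicMap φ x a) (cyclicMap φ x b) = ((⟪a, b⟫ : ℝ) : ℂ) := by
  refine (ContinuousMap.toLp_denseRange ℝ _ ℝ (by simp)).induction_on₂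
    (isClosed_eq (by fun_prop) (by fun_prop)) (fun f g => ?_) a b
  rw [cyclicMap_toLp, cyclicMap_toLp, inner_starAlgHom_apply_starAlgHom_apply, inner_toLp]

theorem norm_cyclicMap (x : H) (a : Lp ℝ 2 (vectorMeasure φ x)) :
    ‖cyclicMap φ x a‖ = ‖a‖ := by
  have h := inner_cyclicMap φ x a a
  rw [inner_self_eq_norm_sq_to_K, real_inner_self_eq_norm_sq] at h
  exact (sq_eq_sq₀ (norm_nonneg _) (norm_nonneg _)).1 (Complex.ofReal_injective (by simpa using h))

/-- The map `x ↦ E(Δ) x` for the spectral measure `E` of `φ`: the indicator of `Δ` in the cyclic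
subspace of `x`. As `x` varies so does the cyclic subspace, so linearity is not immediate; it comes
from approximating `E(Δ)` pointwise by the operators `φ(f)`. -/
noncomputable def spectralMap {Δ : Set X} (hΔ : MeasurableSet Δ) (x : H) : H :=
  cyclicMap φ x (indicatorConstLp 2 hΔ (measure_ne_top _ _) 1)

theorem spectralMap_univ (x : H) : spectralMap φ MeasurableSet.univ x = x := by
  rw [spectralMap, indicatorConstLp_univ]
  exact (cyclicMap_toLp φ x 1).trans (by rw [map_one, one_apply_eq_self])

theorem inner_spectralMap {Δ Δ' : Set X} (hΔ : MeasurableSet Δ) (hΔ' : MeasurableSet Δ') (x : H) :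
    inner ℂ (spectralMap φ hΔ x) (spectralMap φ hΔ' x) =
      ((vectorMeasure φ x).real (Δ ∩ Δ') : ℂ) := by
  rw [spectralMap, spectralMap, inner_cyclicMap, L2.inner_indicatorConstLp_one_indicatorConstLp_one]
  rfl

theorem inner_self_spectralMap {Δ : Set X} (hΔ : MeasurableSet Δ) (x : H) :
    inner ℂ x (spectralMap φ hΔ x) = ((vectorMeasure φ x).real Δ : ℂ) := by
  simpa only [spectralMap_univ, Set.univ_inter] using inner_spectralMap φ .univ hΔ x

theorem norm_spectralMap_le {Δ : Set X} (hΔ : MeasurableSet Δ) (x : H) :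
    ‖spectralMap φ hΔ x‖ ≤ ‖x‖ := by
  have key : ∀ {Δ : Set X} (hΔ : MeasurableSet Δ),
      ‖spectralMap φ hΔ x‖ ^ 2 = (vectorMeasure φ x).real Δ := fun hΔ => by
    have h := inner_spectralMap φ hΔ hΔ x
    rw [inner_self_eq_norm_sq_to_K, Set.inter_self] at h
    exact Complex.ofReal_injective (by simpa using h)
  have h := measureReal_mono (μ := vectorMeasure φ x) (Set.subset_univ Δ)
  rw [← key hΔ, ← key .univ, spectralMap_univ] at h
  exact (sq_le_sq₀ (norm_nonneg _) (norm_nonneg _)).1 h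

theorem exists_norm_spectralMap_sub_le {Δ : Set X} (hΔ : MeasurableSet Δ) (s : Finset H) {ε : ℝ}
    (hε : 0 < ε) : ∃ f : C(X, ℝ), ∀ x ∈ s, ‖φ f x - spectralMap φ hΔ x‖ ≤ ε := by
  obtain ⟨g, hg, -⟩ := MemLp.exists_boundedContinuous_eLpNorm_sub_le (p := 2) (by simp)
    (memLp_indicator_const 2 hΔ (1 : ℝ) (.inr (measure_ne_top (∑ x ∈ s, vectorMeasure φ x) _)))
    (ENNReal.ofReal_pos.2 hε).ne'
  refine ⟨g.toContinuousMap, fun x hx => ?_⟩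
  rw [spectralMap, ← cyclicMap_toLp, ← map_sub, norm_cyclicMap]
  have hle : vectorMeasure φ x ≤ ∑ x ∈ s, vectorMeasure φ x :=
    Finset.single_le_sum (fun _ _ => Measure.zero_le _) hx
  rw [← dist_eq_norm, dist_comm, Lp.dist_def]
  refine ENNReal.toReal_le_of_le_ofReal hε.le (le_trans (le_of_eq (eLpNorm_congr_ae ?_))
    ((eLpNorm_mono_measure _ hle).trans hg))
  exact indicatorConstLp_coeFn.sub (ContinuousMap.coeFn_toLp _ _)

theorem spectralMap_mem_closure {Δ : Set X} (hΔ : MeasurableSet Δ) :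
    spectralMap φ hΔ ∈ closure (Set.range ((↑) : (H →ₗ[ℂ] H) → H → H)) := by
  rw [mem_closure_iff_nhds_basis (nhds_pi (A := fun _ => H) ▸
    hasBasis_pi fun x => Metric.nhds_basis_closedBall)]
  rintro ⟨s, r⟩ ⟨hs, hr⟩
  have hε : ∀ᶠ ε : ℝ in 𝓝[>] 0, 0 < ε ∧ ∀ x ∈ s, ε ≤ r x :=
    eventually_mem_nhdsWithin.and <| hs.eventually_all.2 fun x hx =>
      nhdsWithin_le_nhds (Iic_mem_nhds (hr x hx))
  obtain ⟨ε, hε, hεr⟩ := hε.exists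
  obtain ⟨f, hf⟩ := exists_norm_spectralMap_sub_le φ hΔ hs.toFinset hε
  exact ⟨_, ⟨φ f, rfl⟩, fun x hx => mem_closedBall_iff_norm.2 <|
    (hf x (hs.mem_toFinset.2 hx)).trans (hεr x hx)⟩

/-- The spectral projection `E(Δ)` of `φ`. -/
noncomputable def spectralOp {Δ : Set X} (hΔ : MeasurableSet Δ) : H →L[ℂ] H :=
  (linearMapOfMemClosureRangeCoe _ (spectralMap_mem_closure φ hΔ)).mkContinuous 1 fun x => by
    simpa using norm_spectralMap_le φ hΔ x

theorem inner_self_spectralOp {Δ : Set X} (hΔ : MeasurableSet Δ) (x : H) :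
    inner ℂ x (spectralOp φ hΔ x) = ((vectorMeasure φ x).real Δ : ℂ) :=
  inner_self_spectralMap φ hΔ x

open Classical in
/-- The spectral measure `E` of `φ`, with `φ(f) = ∫ f dE`; its value on a non-measurable set is
set to `0`. -/
noncomputable def spectralPOVM : POVM X H where
  op Δ := if hΔ : MeasurableSet Δ then spectralOp φ hΔ else 0
  isPositive Δ hΔ := by
    rw [dif_pos hΔ]
    exact isPositive_of_inner_eq (fun _ => measureReal_nonneg) (inner_self_spectralOp φ hΔ)
  weak_sigma_additive Δ hΔ hd := by
    simp only [dif_pos (hΔ _), dif_pos (MeasurableSet.iUnion hΔ)]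
    refine hasSum_inner_apply fun x => ?_
    simp only [inner_self_spectralOp]
    exact Complex.hasSum_ofReal.2 (hasSum_measureReal_iUnion hΔ hd)
  normalized := by
    rw [dif_pos .univ]
    exact ContinuousLinearMap.ext (spectralMap_univ φ)

theorem spectralPOVM_op {Δ : Set X} (hΔ : MeasurableSet Δ) :
    (spectralPOVM φ).op Δ = spectralOp φ hΔ :=
  dif_pos hΔ

theorem scalarMeasure_spectralPOVM (x : H) :
    (spectralPOVM φ).scalarMeasure x = vectorMeasure φ x := by
  ext Δ hΔ
  rw [POVM.scalarMeasure_apply _ _ hΔ, spectralPOVM_op φ hΔ, inner_self_spectralOp]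
  exact ofReal_measureReal

theorem spectralPOVM_isIntegral (f : C(X, ℝ)) : (spectralPOVM φ).IsIntegral f (φ f) := fun x => by
  rw [scalarMeasure_spectralPOVM, inner_apply_self_eq_ofReal_iff, inner_starAlgHom_apply_self]

theorem spectralPOVM_isPVM : (spectralPOVM φ).IsPVM := by
  intro Δ Δ' hΔ hΔ' hd
  refine ext_inner_apply_self fun x => ?_
  rw [mul_apply_eq_comp]
  refine (((spectralPOVM φ).isPositive Δ hΔ).isSymmetric x _).symm.trans ?_
  rw [spectralPOVM_op φ hΔ, spectralPOVM_op φ hΔ']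
  refine (inner_spectralMap φ hΔ hΔ' x).trans ?_
  simp [hd.inter_eq]

end SpectralMeasure

section Gelfand

open WeakDual

universe u

variable (A : Type*) [CommCStarAlgebra A]

/-- The inverse Gelfand transform on the real functions, which correspond to the self-adjoint
elements of `A`. -/
noncomputable def realGelfandInverse : C(characterSpace ℂ A, ℝ) →⋆ₐ[ℝ] A where
  toAlgHom := (((gelfandStarTransform A).symm : _ →ₐ[ℂ] A).restrictScalars ℝ).comp
    (Complex.ofRealAm.compLeftContinuous ℝ Complex.continuous_ofReal)
  map_star' f := by
    refine (congrArg (gelfandStarTransform A).symm ?_).trans (map_star _ _)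
    ext t
    exact (Complex.conj_ofReal _).symm

theorem gelfandTransform_realGelfandInverse (f : C(characterSpace ℂ A, ℝ))
    (χ : characterSpace ℂ A) :
    gelfandStarTransform A (realGelfandInverse A f) χ = (f χ : ℂ) :=
  congrArg (fun g : C(_, ℂ) => g χ) ((gelfandStarTransform A).apply_symm_apply _)

theorem norm_realGelfandInverse (f : C(characterSpace ℂ A, ℝ)) :
    ‖realGelfandInverse A f‖ = ‖f‖ := by
  have h := (gelfandTransform_isometry A).norm_map_of_map_zero (map_zero _) (realGelfandInverse A f)
  rw [← h]
  simp_rw [ContinuousMap.norm_eq_iSup_norm]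
  exact congrArg _ (funext fun χ =>
    (congrArg norm (gelfandTransform_realGelfandInverse A f χ)).trans (Complex.norm_real _))

theorem range_realGelfandInverse : Set.range (realGelfandInverse A) = {a | IsSelfAdjoint a} := by
  refine Set.Subset.antisymm (Set.range_subset_iff.2 fun f => (IsSelfAdjoint.all f).map _)
    fun a ha => ?_
  refine ⟨⟨fun χ => (gelfandStarTransform A a χ).re, by fun_prop⟩,
    (gelfandStarTransform A).injective (ContinuousMap.ext fun χ => ?_)⟩
  exact (gelfandTransform_realGelfandInverse A _ χ).trans <| Complex.conj_eq_iff_re.1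
    (congrArg (fun g : C(_, ℂ) => g χ) (ha.map (gelfandStarTransform A)).star_eq)

theorem exists_realGelfand {B : Type u} [CStarAlgebra B] (D : StarSubalgebra ℂ B)
    (hD : IsClosed (D : Set B)) (hcomm : ∀ a ∈ D, ∀ b ∈ D, Commute a b) :
    ∃ (Y : Type u) (_ : TopologicalSpace Y) (_ : CompactSpace Y) (_ : T2Space Y)
      (ψ : C(Y, ℝ) →⋆ₐ[ℝ] B), Isometry ψ ∧ Set.range ψ = {a ∈ D | IsSelfAdjoint a} := by
  let _ : CommCStarAlgebra D :=
    { StarSubalgebra.cstarAlgebra D (h_closed := hD) with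
      mul_comm := fun a b => Subtype.ext (hcomm a a.2 b b.2) }
  let ι : D →⋆ₐ[ℝ] B :=
    { toAlgHom := D.subtype.toAlgHom.restrictScalars ℝ
      map_star' := map_star D.subtype }
  refine ⟨characterSpace ℂ D, inferInstance, inferInstance, inferInstance,
    ι.comp (realGelfandInverse D),
    AddMonoidHomClass.isometry_of_norm _ (norm_realGelfandInverse D), ?_⟩
  rw [StarAlgHom.coe_comp, Set.range_comp, range_realGelfandInverse]
  ext a
  constructor
  · rintro ⟨b, hb, rfl⟩
    exact ⟨b.2, hb.map ι⟩
  · rintro ⟨haD, ha⟩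
    exact ⟨⟨a, haD⟩, Subtype.ext ha, rfl⟩

end Gelfand

section VonNeumann

variable {H : Type*} [NormedAddCommGroup H] [InnerProductSpace ℂ H] [CompleteSpace H]

theorem subset_vonNeumannGenerated (S : Set (H →L[ℂ] H)) :
    S ⊆ (vonNeumannGenerated S : Set (H →L[ℂ] H)) :=
  (vonNeumannGenerated_le_iff S _).1 le_rfl

theorem commute_of_mem_vonNeumannGenerated {S : Set (H →L[ℂ] H)}
    (hS : ∀ s ∈ S, IsSelfAdjoint s) (hc : ∀ s ∈ S, ∀ t ∈ S, Commute s t)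
    {a b : H →L[ℂ] H} (ha : a ∈ vonNeumannGenerated S) (hb : b ∈ vonNeumannGenerated S) :
    Commute a b := by
  have hS' : ∀ s ∈ S, s ∈ StarSubalgebra.centralizer ℂ S := fun s hs =>
    (StarSubalgebra.mem_centralizer_iff ℂ).2 fun t ht => by
      rw [(hS t ht).star_eq]
      exact ⟨hc t ht s hs, hc t ht s hs⟩
  have hle : S ⊆ ((vonNeumannGenerated S).commutant : Set (H →L[ℂ] H)) := fun s hs =>
    VonNeumannAlgebra.mem_commutant_iff.2 fun g hg =>
      ((StarSubalgebra.mem_centralizer_iff ℂ).1 hg s (hS' s hs)).1.symm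
  exact VonNeumannAlgebra.mem_commutant_iff.1 ((vonNeumannGenerated_le_iff S _).2 hle hb) a ha

theorem isClosed_vonNeumannAlgebra (W : VonNeumannAlgebra H) : IsClosed (W : Set (H →L[ℂ] H)) := by
  rw [← W.centralizer_centralizer]
  exact Set.isClosed_centralizer _

theorem starProjection_ker_mem {W : VonNeumannAlgebra H} {T : H →L[ℂ] H} (hT : T ∈ W) :
    T.ker.starProjection ∈ W := by
  rw [VonNeumannAlgebra.IsStarProjection.mem_iff isStarProjection_starProjection]
  intro y hy x hx
  rw [Submodule.range_starProjection] at hx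
  rw [Submodule.mem_comap, Submodule.range_starProjection]
  have hcomm : T * y = y * T := VonNeumannAlgebra.mem_commutant_iff.1 hy T hT
  have hTx : T x = 0 := hx
  calc T (y x) = y (T x) := DFunLike.congr_fun hcomm x
    _ = 0 := by rw [hTx, map_zero]

variable {Y : Type*} [TopologicalSpace Y] {ψ : C(Y, ℝ) →⋆ₐ[ℝ] (H →L[ℂ] H)}
  {W : VonNeumannAlgebra H}

theorem exists_idempotent_of_mul_eq_zero (hψ : Function.Injective ψ)
    (hW : Set.range ψ = {T ∈ W | IsSelfAdjoint T}) {f g : C(Y, ℝ)} (hfg : f * g = 0) :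
    ∃ q : C(Y, ℝ), IsIdempotentElem q ∧ f * q = 0 ∧ q * g = g := by
  -- `q` represents the projection onto the kernel of `ψ f`, which contains the range of `ψ g`.
  have hfW : ψ f ∈ W := (hW.subset ⟨f, rfl⟩).1
  obtain ⟨q, hq⟩ : (ψ f).ker.starProjection ∈ Set.range ψ :=
    hW.superset ⟨starProjection_ker_mem hfW, isStarProjection_starProjection.isSelfAdjoint⟩
  refine ⟨q, hψ ?_, hψ ?_, hψ ?_⟩
  · rw [map_mul, hq]
    exact isStarProjection_starProjection.isIdempotentElem
  · rw [map_mul, map_zero, hq]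
    exact ContinuousLinearMap.ext fun x => (ψ f).ker.starProjection_apply_mem x
  · rw [map_mul, hq]
    refine ContinuousLinearMap.ext fun x => Submodule.starProjection_eq_self_iff.2 ?_
    change (ψ f * ψ g) x = 0
    rw [← map_mul, hfg, map_zero, zero_apply]

theorem totallySeparatedSpace_of_range_eq [CompactSpace Y] [T2Space Y]
    (hψ : Function.Injective ψ) (hW : Set.range ψ = {T ∈ W | IsSelfAdjoint T}) :
    TotallySeparatedSpace Y := by
  refine totallySeparatedSpace_iff_exists_isClopen.2 fun y z hyz => ?_
  obtain ⟨f, hfy, hfz, -⟩ := exists_continuous_zero_one_of_isClosed (isClosed_singleton (x := y))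
    (isClosed_singleton (x := z)) (Set.disjoint_singleton.2 hyz)
  let g : C(Y, ℝ) := f - ContinuousMap.const Y (1 / 2)
  have hg : (g ⊔ 0) * (g ⊓ 0) = 0 := by
    ext t
    rcases le_total (g t) 0 with h | h <;> simp [h]
  obtain ⟨q, hq, hgq, hqg⟩ := exists_idempotent_of_mul_eq_zero hψ hW hg
  have hqz : q z = 0 := by
    have h : (g z ⊔ 0) * q z = 0 := congrArg (fun k : C(Y, ℝ) => k z) hgq
    have hz : g z = 1 / 2 := by norm_num [g, hfz rfl]
    simpa [hz] using h
  have hqy : q y = 1 := by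
    have h : q y * (g y ⊓ 0) = g y ⊓ 0 := congrArg (fun k : C(Y, ℝ) => k y) hqg
    have hy : g y = -1 / 2 := by norm_num [g, hfy rfl]
    rw [hy, inf_of_le_left (by norm_num)] at h
    linarith
  have hq01 : q ⁻¹' {1} = q ⁻¹' {0}ᶜ := Set.ext fun t => by
    rcases IsIdempotentElem.iff_eq_zero_or_one.1 (congrArg (fun k : C(Y, ℝ) => k t) hq)
      with h | h <;> simp [h]
  exact ⟨q ⁻¹' {1}, ⟨isClosed_singleton.preimage q.continuous,
    hq01 ▸ isOpen_compl_singleton.preimage q.continuous⟩, hqy, by simp [hqz]⟩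

theorem apply_mem_of_apply_id_mem {s : Set ℝ} [CompactSpace s]
    {φ : C(s, ℝ) →⋆ₐ[ℝ] (H →L[ℂ] H)} (hφ : Continuous φ)
    (hid : φ (.restrict s (.id ℝ)) ∈ W) (f : C(s, ℝ)) : φ f ∈ W := by
  induction f using ContinuousMap.induction_on_of_compact with
  | const r =>
    refine (AlgHomClass.commutes φ r : φ (.const _ r) = _) ▸ ?_
    exact W.algebraMap_mem (r : ℂ)
  | id => exact hid
  | star_id => exact hid
  | add f g hf hg => exact map_add φ f g ▸ add_mem hf hg
  | mul f g hf hg => exact map_mul φ f g ▸ mul_mem hf hg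
  | frequently f hf =>
    exact ((isClosed_vonNeumannAlgebra W).preimage hφ).closure_subset
      (mem_closure_iff_frequently.2 hf)

end VonNeumann

section Coding

variable {Y : Type*} [TopologicalSpace Y]

theorem exists_continuous_icc_of_isClopen {ι : Type*} [Denumerable ι]
    {C : ι → Set Y} (hC : ∀ i, IsClopen (C i)) :
    ∃ a : C(Y, Set.Icc (0 : ℝ) 1), ∀ y z, a y = a z → ∀ i, y ∈ C i ↔ z ∈ C i := by
  let b : Y → ℕ → Bool := fun y n => (C (Denumerable.ofNat ι n)).boolIndicator y
  have hb : Continuous b :=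
    continuous_pi fun n => (continuous_boolIndicator_iff_isClopen _).2 (hC _)
  let j : cantorSet → Set.Icc (0 : ℝ) 1 := Set.inclusion cantorSet_subset_unitInterval
  have hj : Continuous j := continuous_inclusion cantorSet_subset_unitInterval
  refine ⟨⟨fun y => j (cantorSetHomeomorphNatToBool.symm (b y)),
    hj.comp (cantorSetHomeomorphNatToBool.symm.continuous.comp hb)⟩, fun y z hyz i => ?_⟩
  have h : b y = b z := cantorSetHomeomorphNatToBool.symm.injective
    (Set.inclusion_injective cantorSet_subset_unitInterval hyz)
  have hi := congrFun h (Encodable.encode i)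
  simp only [b, Denumerable.ofNat_encode] at hi
  rw [Set.mem_iff_boolIndicator, hi, ← Set.mem_iff_boolIndicator]

theorem exists_continuous_icc_separating [CompactSpace Y] [T2Space Y] [TotallyDisconnectedSpace Y]
    (h : ℕ → C(Y, ℝ)) :
    ∃ a : C(Y, Set.Icc (0 : ℝ) 1), ∀ y z, a y = a z → ∀ n, h n y = h n z := by
  have hC : ∀ j : ℕ × ℚ × ℚ, ∃ C : Set Y, IsClopen C ∧
      (j.2.1 < j.2.2 → (∀ y, h j.1 y ≤ j.2.1 → y ∈ C) ∧ ∀ y ∈ C, h j.1 y < j.2.2) := by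
    rintro ⟨n, r, s⟩
    by_cases hrs : r < s
    · obtain ⟨C, hC, hrC, hCs⟩ := exists_clopen_of_closed_subset_open
        (isClosed_le (h n).continuous continuous_const)
        (isOpen_lt (h n).continuous continuous_const)
        (fun y (hy : h n y ≤ r) => hy.trans_lt (Rat.cast_lt.2 hrs))
      exact ⟨C, hC, fun _ => ⟨fun y hy => hrC hy, fun y hy => hCs hy⟩⟩
    · exact ⟨∅, isClopen_empty, fun hrs' => absurd hrs' hrs⟩
  choose C hC hCh using hC
  obtain ⟨a, ha⟩ := exists_continuous_icc_of_isClopen hC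
  have key : ∀ {y z}, a y = a z → ∀ n, h n z ≤ h n y := fun {y z} hyz n => by
    by_contra! hlt
    obtain ⟨r, hyr, hrz⟩ := exists_rat_btwn hlt
    obtain ⟨s, hrs, hsz⟩ := exists_rat_btwn hrz
    have hC := hCh (n, r, s) (Rat.cast_lt.1 hrs)
    exact (hC.2 z ((ha y z hyz _).1 (hC.1 y hyr.le))).not_gt hsz
  exact ⟨a, fun y z hyz n => (key hyz.symm n).antisymm (key hyz n)⟩

end Coding

section ProbabilisticRetraction

open scoped NNReal

theorem exists_isFiniteMeasure_isOpenPosMeasure (Y : Type*) [TopologicalSpace Y]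
    [TopologicalSpace.SeparableSpace Y] [Nonempty Y] [MeasurableSpace Y] [OpensMeasurableSpace Y] :
    ∃ ν : Measure Y, IsFiniteMeasure ν ∧ ν.IsOpenPosMeasure := by
  let d : ℕ → Y := TopologicalSpace.denseSeq Y
  refine ⟨(Measure.count : Measure ℕ).toFinite.map d, inferInstance, ⟨fun U hU hne => ?_⟩⟩
  rw [Measure.map_apply (measurable_from_top : Measurable d) hU.measurableSet]
  obtain ⟨n, hdU⟩ := (TopologicalSpace.denseRange_denseSeq Y).exists_mem_open hU hne
  exact fun h0 => (Measure.count_ne_zero (s := d ⁻¹' U) ⟨n, hdU⟩)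
    (absolutelyContinuous_toFinite _ h0)

theorem tendsto_diracProba_of_ae_dist_le {Y ι : Type*} [PseudoMetricSpace Y] [MeasurableSpace Y]
    [OpensMeasurableSpace Y] {l : Filter ι} {P : ι → ProbabilityMeasure Y} {z : Y} {r : ι → ℝ}
    (hP : ∀ i, ∀ᵐ y ∂(P i : Measure Y), dist y z ≤ r i) (hr : Tendsto r l (𝓝 0)) :
    Tendsto P l (𝓝 (diracProba z)) := by
  refine ProbabilityMeasure.tendsto_iff_forall_integral_tendsto.2 fun f => ?_
  rw [show ∫ y, f y ∂(diracProba z : Measure Y) = f z from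
    integral_dirac' _ _ f.continuous.stronglyMeasurable]
  refine Metric.tendsto_nhds.2 fun ε hε => ?_
  obtain ⟨δ, hδ, hfδ⟩ := Metric.continuousAt_iff.1 f.continuous.continuousAt (ε / 2) (half_pos hε)
  filter_upwards [hr.eventually (gt_mem_nhds hδ)] with i hi
  have hclose : ∀ᵐ y ∂(P i : Measure Y), ‖f y - f z‖ ≤ ε / 2 :=
    (hP i).mono fun y hy => (hfδ (hy.trans_lt hi)).le
  calc dist (∫ y, f y ∂(P i : Measure Y)) (f z)
      = ‖∫ y, (f y - f z) ∂(P i : Measure Y)‖ := by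
        rw [integral_sub (f.integrable _) (integrable_const _), integral_const, probReal_univ,
          one_smul, dist_eq_norm]
    _ ≤ ε / 2 := by simpa using norm_integral_le_of_norm_le_const hclose
    _ < ε := half_lt_self hε

variable {X : Type*} [PseudoMetricSpace X] (s : Set X)

/-- The weight of a point `y` of `s` as an approximate projection of `x ∉ s` to `s`: it is positive
exactly when `dist x y < 2 * infDist x s`. For `x ∈ s` it is a junk value. -/
noncomputable def retractionWeight (x : X) (y : s) : ℝ≥0 :=
  (2 - dist x y / Metric.infDist x s).toNNReal

variable {s}

theorem continuous_retractionWeight (x : X) : Continuous (retractionWeight s x) := by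
  unfold retractionWeight
  fun_prop

theorem continuousAt_retractionWeight {x : X} (hx : Metric.infDist x s ≠ 0) (y : s) :
    ContinuousAt (fun x => retractionWeight s x y) x := by
  unfold retractionWeight
  have := Metric.continuous_infDist_pt s
  fun_prop (disch := assumption)

theorem retractionWeight_le_two (x : X) (y : s) : retractionWeight s x y ≤ 2 :=
  Real.toNNReal_le_iff_le_coe.2 <|
    sub_le_self _ (div_nonneg dist_nonneg Metric.infDist_nonneg)

theorem retractionWeight_ne_zero_iff {x : X} (hx : Metric.infDist x s ≠ 0) {y : s} :
    retractionWeight s x y ≠ 0 ↔ dist x y < 2 * Metric.infDist x s := by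
  rw [retractionWeight, Ne, Real.toNNReal_eq_zero, not_le, sub_pos,
    div_lt_iff₀ (Metric.infDist_nonneg.lt_of_ne' hx)]

variable [MeasurableSpace X] [BorelSpace X] (ν : Measure s) [IsFiniteMeasure ν]

/-- The measure on `s` with density `retractionWeight s x`. -/
noncomputable def retractionDensity (x : X) : FiniteMeasure s :=
  ⟨ν.withDensity fun y => retractionWeight s x y, isFiniteMeasure_withDensity <| ne_top_of_le_ne_top
    (ENNReal.mul_ne_top ENNReal.ofNat_ne_top (measure_ne_top ν Set.univ)) <|
      (lintegral_mono fun y => ENNReal.coe_le_coe.2 (retractionWeight_le_two x y)).trans_eq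
        (lintegral_const _)⟩

theorem continuousAt_retractionDensity {x : X} (hx : Metric.infDist x s ≠ 0) :
    ContinuousAt (retractionDensity ν) x := by
  refine FiniteMeasure.tendsto_of_forall_integral_tendsto fun f => ?_
  have hint (x : X) : ∫ y, f y ∂(retractionDensity ν x : Measure s)
      = ∫ y, retractionWeight s x y • f y ∂ν :=
    integral_withDensity_eq_integral_smul (continuous_retractionWeight x).measurable f
  simp_rw [hint]
  refine continuousAt_of_dominated (bound := fun _ => 2 * ‖f‖) (.of_forall fun x => ?_)
    (.of_forall fun x => .of_forall fun y => ?_) (integrable_const _)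
    (.of_forall fun y => (continuousAt_retractionWeight hx y).smul continuousAt_const)
  · exact ((continuous_retractionWeight x).smul f.continuous).aestronglyMeasurable
  · rw [NNReal.smul_def, norm_smul, NNReal.norm_eq]
    gcongr
    · exact retractionWeight_le_two x y
    · exact f.norm_coe_le_norm y

theorem retractionDensity_ne_zero [ν.IsOpenPosMeasure] (hs : s.Nonempty) {x : X}
    (hx : Metric.infDist x s ≠ 0) : retractionDensity ν x ≠ 0 := by
  intro h0
  have hae : (fun y => (retractionWeight s x y : ENNReal)) =ᵐ[ν] 0 :=
    (withDensity_eq_zero_iff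
      (continuous_retractionWeight x).measurable.coe_nnreal_ennreal.aemeasurable).1
      (congrArg Subtype.val h0)
  have hzero := (Continuous.ae_eq_iff_eq ν
    (ENNReal.continuous_coe.comp (continuous_retractionWeight x)) continuous_const).1 hae
  obtain ⟨y, hy, hxy⟩ := (Metric.infDist_lt_iff hs).1
    (lt_two_mul_self (Metric.infDist_nonneg.lt_of_ne' hx))
  exact (retractionWeight_ne_zero_iff hx (y := ⟨y, hy⟩)).2 hxy
    (ENNReal.coe_eq_zero.1 (congrFun hzero ⟨y, hy⟩))

theorem ae_retractionDensity_dist_lt {x : X} (hx : Metric.infDist x s ≠ 0) :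
    ∀ᵐ y : s ∂(retractionDensity ν x : Measure s), dist x y < 2 * Metric.infDist x s :=
  (ae_withDensity_iff (continuous_retractionWeight x).measurable.coe_nnreal_ennreal).2 <|
    .of_forall fun _ hy => (retractionWeight_ne_zero_iff hx).1 (by simpa using hy)

theorem ae_normalize_retractionDensity_dist_le [ν.IsOpenPosMeasure] [Nonempty s] {x : X}
    (hx : Metric.infDist x s ≠ 0) (z : s) :
    ∀ᵐ y : s ∂((retractionDensity ν x).normalize : Measure s), dist y z ≤ 3 * dist x z := by
  rw [FiniteMeasure.toMeasure_normalize_eq_of_nonzero _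
    (retractionDensity_ne_zero ν (Set.nonempty_coe_sort.1 ‹_›) hx)]
  filter_upwards [Measure.ae_smul_measure (ae_retractionDensity_dist_lt ν hx) _] with y hy
  have := Metric.infDist_le_dist_of_mem (x := x) z.2
  have := dist_triangle_left (y : X) z x
  rw [Subtype.dist_eq]
  linarith

/-- A retraction of `X` onto `s` need not exist, but one that is random and continuous in law
does. -/
theorem exists_probabilistic_retraction [TopologicalSpace.SeparableSpace s] (hs : IsClosed s)
    (hne : s.Nonempty) :
    ∃ κ : C(X, ProbabilityMeasure s), ∀ y : s, κ y = diracProba y := by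
  classical
  have : Nonempty s := hne.to_subtype
  obtain ⟨ν, _, _⟩ := exists_isFiniteMeasure_isOpenPosMeasure s
  have hinf {x : X} : x ∉ s → Metric.infDist x s ≠ 0 := fun hx =>
    ((hs.notMem_iff_infDist_pos hne).1 hx).ne'
  let κ (x : X) : ProbabilityMeasure s :=
    if hx : x ∈ s then diracProba ⟨x, hx⟩ else (retractionDensity ν x).normalize
  have hκ_mem (y : s) : κ y = diracProba y := dif_pos y.2
  have hκ_notMem {x : X} (hx : x ∉ s) : κ x = (retractionDensity ν x).normalize := dif_neg hx
  have hdist (z : s) (x : X) : ∀ᵐ y ∂(κ x : Measure s), dist y z ≤ 3 * dist x z := by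
    by_cases hx : x ∈ s
    · lift x to s using hx
      rw [hκ_mem]
      refine ae_dirac_iff (measurableSet_le (by fun_prop) (by fun_prop)) |>.2 ?_
      exact le_mul_of_one_le_left dist_nonneg (by norm_num)
    · rw [hκ_notMem hx]
      exact ae_normalize_retractionDensity_dist_le ν (hinf hx) z
  refine ⟨⟨κ, continuous_iff_continuousAt.2 fun x => ?_⟩, hκ_mem⟩
  by_cases hx : x ∈ s
  · lift x to s using hx
    rw [ContinuousAt, hκ_mem]
    refine tendsto_diracProba_of_ae_dist_le (hdist x) ?_
    exact (by fun_prop : Continuous fun z : X => 3 * dist z x).tendsto' _ _ (by simp)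
  · have hlim : ContinuousAt (fun x => (retractionDensity ν x).normalize) x :=
      FiniteMeasure.tendsto_normalize_of_tendsto (continuousAt_retractionDensity ν (hinf hx))
        (retractionDensity_ne_zero ν hne (hinf hx))
    refine hlim.congr ?_
    filter_upwards [hs.isOpen_compl.mem_nhds hx] with z hz using (hκ_notMem hz).symm

end ProbabilisticRetraction

section KernelExtension

variable {X T Y : Type*} [MeasurableSpace X] [TopologicalSpace Y] [CompactSpace Y]

theorem measurable_of_continuous_measureReal [TopologicalSpace T] [MeasurableSpace T]
    [OpensMeasurableSpace T] {m : T → Measure X} [∀ t, IsFiniteMeasure (m t)]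
    (hm : ∀ Δ, MeasurableSet Δ → Continuous fun t => (m t).real Δ) : Measurable m :=
  Measure.measurable_of_measurable_coe _ fun Δ hΔ => by
    simpa only [ofReal_measureReal (measure_ne_top _ _)] using (hm Δ hΔ).measurable.ennreal_ofReal

theorem exists_rangeFactorization_measure [TopologicalSpace T] [T2Space T] {a : Y → T}
    (ha : Continuous a) {M : Y → Measure X}
    (hM : ∀ Δ, MeasurableSet Δ → Continuous fun y => (M y).real Δ)
    (haM : ∀ y z, a y = a z → M y = M z) :
    ∃ N : Set.range a → Measure X, (∀ y, N (Set.rangeFactorization a y) = M y) ∧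
      ∀ Δ, MeasurableSet Δ → Continuous fun t => (N t).real Δ := by
  have hq : IsQuotientMap (Set.rangeFactorization a) :=
    ha.rangeFactorization.isClosedMap.isQuotientMap ha.rangeFactorization
      Set.rangeFactorization_surjective
  let N (t : Set.range a) : Measure X := M t.2.choose
  have hN (y : Y) : N (Set.rangeFactorization a y) = M y :=
    haM _ _ (Set.rangeFactorization a y).2.choose_spec
  refine ⟨N, hN, fun Δ hΔ => hq.continuous_iff.2 ?_⟩
  simpa only [Function.comp_def, hN] using hM Δ hΔ

theorem exists_kernel_comp_eq [MetricSpace T] [MeasurableSpace T] [BorelSpace T] [Nonempty X]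
    {a : Y → T} (ha : Continuous a) {M : Y → Measure X} [∀ y, IsProbabilityMeasure (M y)]
    (hM : ∀ Δ, MeasurableSet Δ → Continuous fun y => (M y).real Δ)
    (haM : ∀ y z, a y = a z → M y = M z) :
    ∃ μ : Kernel T X, IsMarkovKernel μ ∧
      (∀ Δ, MeasurableSet Δ → Continuous fun t => (μ t).real Δ) ∧ ∀ y, μ (a y) = M y := by
  obtain _ | _ := isEmpty_or_nonempty Y
  · exact ⟨Kernel.const T (Measure.dirac (Classical.arbitrary X)), inferInstance,
      fun _ _ => by simpa only [Kernel.const_apply] using continuous_const, isEmptyElim⟩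
  obtain ⟨N, hNM, hN⟩ := exists_rangeFactorization_measure ha hM haM
  have : ∀ t, IsProbabilityMeasure (N t) := fun t => by
    obtain ⟨y, rfl⟩ := Set.rangeFactorization_surjective t
    rw [hNM]
    infer_instance
  have hNm : Measurable N := measurable_of_continuous_measureReal hN
  have hcpt : IsCompact (Set.range a) := isCompact_range ha
  have : CompactSpace (Set.range a) := isCompact_iff_compactSpace.1 hcpt
  obtain ⟨κ, hκ⟩ := exists_probabilistic_retraction hcpt.isClosed (Set.range_nonempty a)
  let m (t : T) : Measure X := (κ t : Measure (Set.range a)).bind N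
  have : ∀ t, IsProbabilityMeasure (m t) := fun t =>
    isProbabilityMeasure_bind hNm.aemeasurable (.of_forall fun t => inferInstance)
  have hmreal (Δ) (hΔ : MeasurableSet Δ) (t) : (m t).real Δ = ∫ y, (N y).real Δ ∂(κ t) := by
    rw [measureReal_def, Measure.bind_apply hΔ hNm.aemeasurable]
    exact (integral_toReal (Measure.measurable_measure.1 hNm Δ hΔ).aemeasurable
      (.of_forall fun _ => measure_lt_top _ _)).symm
  have hm (Δ) (hΔ : MeasurableSet Δ) : Continuous fun t => (m t).real Δ := by
    simp_rw [hmreal Δ hΔ]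
    exact ProbabilityMeasure.continuous_iff_forall_continuous_integral.1 κ.continuous
      (.mkOfCompact ⟨_, hN Δ hΔ⟩)
  refine ⟨⟨m, measurable_of_continuous_measureReal hm⟩, ⟨fun t => inferInstanceAs
    (IsProbabilityMeasure (m t))⟩, hm, fun y => ?_⟩
  change (κ (Set.rangeFactorization a y) : Measure (Set.range a)).bind N = M y
  rw [hκ, ← hNM]
  exact Measure.dirac_bind hNm _

end KernelExtension

section MeasureExistence

variable {X : Type*} [MeasurableSpace X]

theorem exists_isFiniteMeasure_measureReal_eq {k : Set X → ℝ}
    (h0 : ∀ Δ, MeasurableSet Δ → 0 ≤ k Δ)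
    (hk : ∀ Δ : ℕ → Set X, (∀ i, MeasurableSet (Δ i)) → Pairwise (Function.onFun Disjoint Δ) →
      HasSum (fun i => k (Δ i)) (k (⋃ i, Δ i))) :
    ∃ m : Measure X, IsFiniteMeasure m ∧ ∀ Δ, MeasurableSet Δ → m.real Δ = k Δ := by
  have hempty : k ∅ = 0 := by
    have h := hk (fun _ => ∅) (fun _ => MeasurableSet.empty) fun _ _ _ => disjoint_bot_left
    exact tendsto_nhds_unique tendsto_const_nhds h.summable.tendsto_atTop_zero
  let m : Measure X := .ofMeasurable (fun Δ _ => ENNReal.ofReal (k Δ)) (by simp [hempty])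
    fun Δ hΔ hd => by
      have h := hk Δ hΔ hd
      rw [← h.tsum_eq, ENNReal.ofReal_tsum_of_nonneg (fun i => h0 _ (hΔ i)) h.summable]
  have hm {Δ : Set X} (hΔ : MeasurableSet Δ) : m Δ = ENNReal.ofReal (k Δ) :=
    Measure.ofMeasurable_apply Δ hΔ
  refine ⟨m, ⟨hm MeasurableSet.univ ▸ ENNReal.ofReal_lt_top⟩, fun Δ hΔ => ?_⟩
  rw [measureReal_def, hm hΔ, ENNReal.toReal_ofReal (h0 Δ hΔ)]

theorem exists_seq_measurableSet_forall_measure_ext (X : Type*) [MeasurableSpace X]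
    [MeasurableSpace.CountablyGenerated X] :
    ∃ D : ℕ → Set X, (∀ n, MeasurableSet (D n)) ∧ ∀ (P Q : Measure X) [IsFiniteMeasure P]
      [IsFiniteMeasure Q], (∀ n, P.real (D n) = Q.real (D n)) → P = Q := by
  let G : Set (Set X) := generateSetAlgebra (MeasurableSpace.countableGeneratingSet X)
  have hG : IsSetAlgebra G := isSetAlgebra_generateSetAlgebra
  have hgen : ‹MeasurableSpace X› = MeasurableSpace.generateFrom G := by
    rw [generateFrom_generateSetAlgebra_eq, MeasurableSpace.generateFrom_countableGeneratingSet]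
  obtain ⟨D, hD⟩ := (countable_generateSetAlgebra
    (MeasurableSpace.countable_countableGeneratingSet (α := X))).exists_eq_range ⟨∅, hG.empty_mem⟩
  refine ⟨D, fun n => ?_, fun P Q _ _ hPQ => ?_⟩
  · rw [hgen]
    exact MeasurableSpace.measurableSet_generateFrom (hD.superset ⟨n, rfl⟩)
  · have hGPQ : ∀ Δ ∈ G, P Δ = Q Δ := fun Δ hΔ => by
      obtain ⟨n, rfl⟩ := hD.subset hΔ
      exact (measureReal_eq_measureReal_iff).1 (hPQ n)
    exact ext_of_generate_finite G hgen hG.isSetRing.isSetSemiring.isPiSystem hGPQ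
      (hGPQ _ hG.univ_mem)

end MeasureExistence

section FiberMeasures

variable {X Y H : Type*} [MeasurableSpace X] [TopologicalSpace Y]
  [NormedAddCommGroup H] [InnerProductSpace ℂ H] [CompleteSpace H]
  {ψ : C(Y, ℝ) →⋆ₐ[ℝ] (H →L[ℂ] H)}

theorem nonneg_of_isPositive_starAlgHom_apply (hψ : Function.Injective ψ) {f : C(Y, ℝ)}
    (hf : (ψ f).IsPositive) : 0 ≤ f := by
  -- For the negative part `g` of `f`, the operator `ψ(g f g)` is positive, but `g f g = -g³`.
  let g : C(Y, ℝ) := -f ⊔ 0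
  have hg : 0 ≤ g := le_sup_right
  have hgfg : g * f * g = -(g * g * g) := by
    ext y
    rcases le_total (f y) 0 with hy | hy <;> simp [g, hy]
  have hle : ψ (g * f * g) ≤ 0 := by
    rw [hgfg, map_neg, neg_nonpos, ContinuousLinearMap.nonneg_iff_isPositive]
    exact isPositive_starAlgHom_apply ψ (mul_nonneg (mul_nonneg hg hg) hg)
  have hge : 0 ≤ ψ (g * f * g) := by
    rw [map_mul, map_mul]
    exact (isSelfAdjoint_starAlgHom_apply ψ g).conjugate_nonneg
      ((ContinuousLinearMap.nonneg_iff_isPositive _).2 hf)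
  have hzero : g * f * g = 0 := hψ ((le_antisymm hle hge).trans (map_zero ψ).symm)
  refine ContinuousMap.le_def.2 fun y => ?_
  by_contra! hy
  have hgy : g y = -f y := max_eq_left (neg_nonneg.2 hy.le)
  have hzero_y : g y * f y * g y = 0 := DFunLike.congr_fun hzero y
  simp only [hgy, mul_eq_zero, neg_eq_zero, or_self] at hzero_y
  exact hy.ne hzero_y

theorem POVM.exists_fiber_measures [CompactSpace Y] {F : POVM X H} (hF : F.IsUniformlyContinuous)
    (hψ : Isometry ψ) (hrange : ∀ Δ, MeasurableSet Δ → F.op Δ ∈ Set.range ψ) :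
    ∃ M : Y → Measure X, (∀ y, IsProbabilityMeasure (M y)) ∧ ∀ Δ, MeasurableSet Δ →
      ∃ f : C(Y, ℝ), (∀ y, f y = (M y).real Δ) ∧ ψ f = F.op Δ := by
  choose! k hk using hrange
  have hnonneg (Δ) (hΔ : MeasurableSet Δ) : 0 ≤ k Δ :=
    nonneg_of_isPositive_starAlgHom_apply hψ.injective ((hk Δ hΔ).symm ▸ F.isPositive Δ hΔ)
  have huniv : k Set.univ = 1 :=
    hψ.injective <| by rw [hk _ MeasurableSet.univ, F.normalized, map_one]
  have hsum (Δ : ℕ → Set X) (hΔ : ∀ i, MeasurableSet (Δ i))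
      (hd : Pairwise (Function.onFun Disjoint Δ)) :
      Tendsto (fun n => ∑ i ∈ Finset.range n, k (Δ i)) atTop (𝓝 (k (⋃ i, Δ i))) := by
    refine hψ.isEmbedding.tendsto_nhds_iff.2 ?_
    simpa only [Function.comp_def, map_sum, hk _ (hΔ _), hk _ (.iUnion hΔ)] using hF Δ hΔ hd
  have hM (y : Y) : ∃ m : Measure X, IsFiniteMeasure m ∧
      ∀ Δ, MeasurableSet Δ → m.real Δ = k Δ y := by
    refine exists_isFiniteMeasure_measureReal_eq (fun Δ hΔ => hnonneg Δ hΔ y) fun Δ hΔ hd => ?_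
    refine (hasSum_iff_tendsto_nat_of_nonneg (fun i => hnonneg _ (hΔ i) y) _).2 ?_
    simpa [Function.comp_def] using
      ((continuous_eval_const y).tendsto _).comp (hsum Δ hΔ hd)
  choose M _ hM using hM
  refine ⟨M, fun y => isProbabilityMeasure_iff_real.2 ?_, fun Δ hΔ =>
    ⟨k Δ, fun y => (hM y Δ hΔ).symm, hk Δ hΔ⟩⟩
  rw [hM y _ .univ, huniv, ContinuousMap.one_apply]

end FiberMeasures

namespace POVM

variable {X : Type*} [MeasurableSpace X] {H : Type*} [NormedAddCommGroup H]
  [InnerProductSpace ℂ H] [CompleteSpace H]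

theorem inner_op_self (F : POVM X H) (x : H) {Δ : Set X} (hΔ : MeasurableSet Δ) :
    inner ℂ x (F.op Δ x) = ((F.scalarMeasure x).real Δ : ℂ) := by
  rw [measureReal_def, F.scalarMeasure_apply x hΔ,
    ENNReal.toReal_ofReal ((F.isPositive Δ hΔ).re_inner_nonneg_right x)]
  exact ((F.isPositive Δ hΔ).isSymmetric.coe_re_inner_self_apply x).symm

instance isFiniteMeasure_scalarMeasure (F : POVM X H) (x : H) :
    IsFiniteMeasure (F.scalarMeasure x) :=
  ⟨by rw [F.scalarMeasure_apply x MeasurableSet.univ]; exact ENNReal.ofReal_lt_top⟩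

theorem scalarMeasure_real_univ (F : POVM X H) (x : H) :
    (F.scalarMeasure x).real Set.univ = ‖x‖ ^ 2 := by
  have h := F.inner_op_self x MeasurableSet.univ
  rw [F.normalized, one_apply_eq_self, inner_self_eq_norm_sq_to_K] at h
  refine Complex.ofReal_injective (h.symm.trans ?_)
  push_cast
  rfl

theorem op_union (F : POVM X H) {Δ Δ' : Set X} (hΔ : MeasurableSet Δ)
    (hΔ' : MeasurableSet Δ') (hd : Disjoint Δ Δ') : F.op (Δ ∪ Δ') = F.op Δ + F.op Δ' := by
  refine ext_inner_apply_self fun x => ?_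
  rw [add_apply, inner_add_right, F.inner_op_self x hΔ, F.inner_op_self x hΔ',
    F.inner_op_self x (hΔ.union hΔ'), measureReal_union hd hΔ', Complex.ofReal_add]

theorem IsIntegral.norm_le {F : POVM X H} {f : X → ℝ} {T : H →L[ℂ] H} (hT : F.IsIntegral f T)
    {c : ℝ} (hc : 0 ≤ c) (h0 : ∀ t, 0 ≤ f t) (hfc : ∀ t, f t ≤ c) : ‖T‖ ≤ c := by
  refine norm_le_of_inner_eq hc (fun x => integral_nonneg h0) (fun x => ?_)
    fun x => inner_apply_self_eq_ofReal_iff.1 (hT x)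
  calc ∫ t, f t ∂(F.scalarMeasure x) ≤ ∫ _, c ∂(F.scalarMeasure x) :=
        integral_mono_of_nonneg (.of_forall h0) (integrable_const c) (.of_forall hfc)
    _ = c * ‖x‖ ^ 2 := by
        rw [integral_const, F.scalarMeasure_real_univ, smul_eq_mul, mul_comm]

theorem op_iUnion_eq_sum_add_tail (F : POVM X H) {Δ : ℕ → Set X} (hΔ : ∀ i, MeasurableSet (Δ i))
    (hd : Pairwise (Function.onFun Disjoint Δ)) (n : ℕ) :
    F.op (⋃ i, Δ i) = ∑ i ∈ Finset.range n, F.op (Δ i) + F.op (⋃ i ≥ n, Δ i) := by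
  induction n with
  | zero => simp
  | succ n ih =>
    have htail : ⋃ i ≥ n, Δ i = Δ n ∪ ⋃ i ≥ n + 1, Δ i := Set.biUnion_ge Δ n
    have hmeas : MeasurableSet (⋃ i ≥ n + 1, Δ i) := .iUnion fun i => .iUnion fun _ => hΔ i
    have hdisj : Disjoint (Δ n) (⋃ i ≥ n + 1, Δ i) :=
      Set.disjoint_iUnion₂_right.2 fun i hi => hd (Nat.lt_of_succ_le hi).ne
    rw [ih, htail, F.op_union (hΔ n) hmeas hdisj, Finset.sum_range_succ, add_assoc]

theorem isUniformlyContinuous_of_isIntegral_measureReal {T : Type*} [TopologicalSpace T]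
    [CompactSpace T] [MeasurableSpace T] {E : POVM T H} {F : POVM X H} {μ : T → Measure X}
    [∀ t, IsFiniteMeasure (μ t)]
    (hμ : ∀ Δ, MeasurableSet Δ → Continuous fun t => (μ t).real Δ)
    (hF : ∀ Δ, MeasurableSet Δ → E.IsIntegral (fun t => (μ t).real Δ) (F.op Δ)) :
    F.IsUniformlyContinuous := by
  intro Δ hΔ hd
  let R (n : ℕ) : Set X := ⋃ i ≥ n, Δ i
  have hR (n : ℕ) : MeasurableSet (R n) := .iUnion fun i => .iUnion fun _ => hΔ i
  have hpointwise (t : T) : Tendsto (fun n => (μ t).real (R n)) atTop (𝓝 0) :=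
    (ENNReal.tendsto_toReal ENNReal.zero_ne_top).comp
      (tendsto_measure_biUnion_Ici_zero_of_pairwise_disjoint
        (fun i => (hΔ i).nullMeasurableSet) hd)
  have hanti : Antitone fun n t => (μ t).real (R n) := fun m n hmn t =>
    measureReal_mono (Set.biUnion_subset_biUnion_left fun i hi => hmn.trans hi) (measure_ne_top _ _)
  have hdini : TendstoUniformly (fun n t => (μ t).real (R n)) (fun _ => 0) atTop :=
    hanti.tendstoUniformly_of_forall_tendsto (fun n => hμ _ (hR n)) continuous_const hpointwise
  have htail : Tendsto (fun n => F.op (R n)) atTop (𝓝 0) := by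
    refine Metric.tendsto_nhds.2 fun ε hε => ?_
    filter_upwards [Metric.tendstoUniformly_iff.1 hdini (ε / 2) (half_pos hε)] with n hn
    rw [dist_zero_right]
    refine ((hF _ (hR n)).norm_le (half_pos hε).le (fun _ => measureReal_nonneg)
      fun t => ?_).trans_lt (half_lt_self hε)
    exact (le_abs_self _).trans (by simpa [dist_comm, Real.dist_eq] using (hn t).le)
  have hsum (n : ℕ) : ∑ i ∈ Finset.range n, F.op (Δ i) = F.op (⋃ i, Δ i) - F.op (R n) :=
    eq_sub_of_add_eq (F.op_iUnion_eq_sum_add_tail hΔ hd n).symm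
  simpa only [hsum, sub_zero] using htail.const_sub (F.op (⋃ i, Δ i))

end POVM

section StrongFellerSmearing

universe u

variable {X : Type*} {H : Type u} [MeasurableSpace X] [NormedAddCommGroup H] [InnerProductSpace ℂ H]
  [CompleteSpace H] {F : POVM X H}

/-- `F` is obtained by smearing the spectral measure `E` of its sharp version `A` with the strong
Feller Markov kernel `μ`. For `X = ℝ` these are the data asked for by
`POVM.AdmitsStrongFellerKernel`. -/
structure POVM.IsStrongFellerSmearing (F : POVM X H) (A : H →L[ℂ] H)
    (E : POVM (Set.Icc (0 : ℝ) 1) H) (μ : Kernel (Set.Icc (0 : ℝ) 1) X) : Prop where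
  isSelfAdjoint : IsSelfAdjoint A
  isPVM : E.IsPVM
  isIntegral : E.IsIntegral (fun t => (t : ℝ)) A
  generates : vonNeumannGenerated {A} = F.vonNeumann
  isMarkovKernel : IsMarkovKernel μ
  continuous_measureReal : ∀ Δ, MeasurableSet Δ → Continuous fun t => (μ t).real Δ
  isIntegral_measureReal : ∀ Δ, MeasurableSet Δ → E.IsIntegral (fun t => (μ t).real Δ) (F.op Δ)

theorem POVM.admitsStrongFellerKernel_iff {F : POVM ℝ H} :
    F.AdmitsStrongFellerKernel ↔ ∃ A E μ, F.IsStrongFellerSmearing A E μ :=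
  exists₃_congr fun _ _ _ =>
    ⟨fun ⟨hA, hM, hc, hi⟩ => ⟨hA.1, hA.2, hA.3, hA.4, hM, hc, hi⟩,
      fun h => ⟨⟨h.1, h.2, h.3, h.4⟩, h.5, h.6, h.7⟩⟩

theorem POVM.op_mem_vonNeumann (F : POVM X H) {Δ : Set X} (hΔ : MeasurableSet Δ) :
    F.op Δ ∈ F.vonNeumann :=
  subset_vonNeumannGenerated _ ⟨Δ, hΔ, rfl⟩

theorem POVM.IsCommutative.commute_of_mem_vonNeumann (hF : F.IsCommutative) {S T : H →L[ℂ] H}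
    (hS : S ∈ F.vonNeumann) (hT : T ∈ F.vonNeumann) : Commute S T := by
  refine commute_of_mem_vonNeumannGenerated ?_ ?_ hS hT
  · rintro _ ⟨Δ, hΔ, rfl⟩
    exact (F.isPositive Δ hΔ).isSelfAdjoint
  · rintro _ ⟨Δ, hΔ, rfl⟩ _ ⟨Δ', hΔ', rfl⟩
    exact hF Δ Δ' hΔ hΔ'

theorem POVM.IsCommutative.exists_starAlgHom_range_eq (hF : F.IsCommutative) :
    ∃ (Y : Type u) (_ : TopologicalSpace Y) (_ : CompactSpace Y) (_ : T2Space Y)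
      (_ : TotallySeparatedSpace Y) (ψ : C(Y, ℝ) →⋆ₐ[ℝ] (H →L[ℂ] H)),
      Isometry ψ ∧ Set.range ψ = {T ∈ F.vonNeumann | IsSelfAdjoint T} := by
  obtain ⟨Y, _, _, _, ψ, hψ, hrange⟩ := exists_realGelfand F.vonNeumann.toStarSubalgebra
    (isClosed_vonNeumannAlgebra F.vonNeumann) fun S hS T hT => hF.commute_of_mem_vonNeumann hS hT
  exact ⟨Y, inferInstance, inferInstance, inferInstance,
    totallySeparatedSpace_of_range_eq hψ.injective hrange, ψ, hψ, hrange⟩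

theorem POVM.IsStrongFellerSmearing.isCommutative {A : H →L[ℂ] H}
    {E : POVM (Set.Icc (0 : ℝ) 1) H} {μ : Kernel (Set.Icc (0 : ℝ) 1) X}
    (h : F.IsStrongFellerSmearing A E μ) : F.IsCommutative := fun Δ Δ' hΔ hΔ' => by
  refine commute_of_mem_vonNeumannGenerated (S := {A}) ?_ ?_
    (h.generates ▸ F.op_mem_vonNeumann hΔ) (h.generates ▸ F.op_mem_vonNeumann hΔ')
  · simpa only [Set.mem_singleton_iff, forall_eq] using h.isSelfAdjoint
  · simp only [Set.mem_singleton_iff, forall_eq, Commute.refl]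

theorem POVM.IsStrongFellerSmearing.isUniformlyContinuous {A : H →L[ℂ] H}
    {E : POVM (Set.Icc (0 : ℝ) 1) H} {μ : Kernel (Set.Icc (0 : ℝ) 1) X}
    (h : F.IsStrongFellerSmearing A E μ) : F.IsUniformlyContinuous := by
  have := h.isMarkovKernel
  exact isUniformlyContinuous_of_isIntegral_measureReal h.continuous_measureReal
    h.isIntegral_measureReal

theorem POVM.isStrongFellerSmearing_spectralPOVM {Y : Type*} [TopologicalSpace Y]
    [CompactSpace Y] {ψ : C(Y, ℝ) →⋆ₐ[ℝ] (H →L[ℂ] H)} (hψ : Continuous ψ)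
    (hmem : ∀ f, ψ f ∈ F.vonNeumann) (a : C(Y, Set.Icc (0 : ℝ) 1))
    {μ : Kernel (Set.Icc (0 : ℝ) 1) X} [IsMarkovKernel μ]
    (hμ : ∀ Δ, MeasurableSet Δ → Continuous fun t => (μ t).real Δ)
    (hF : ∀ Δ, MeasurableSet Δ → ∃ f : C(Y, ℝ), (∀ y, f y = (μ (a y)).real Δ) ∧ ψ f = F.op Δ) :
    F.IsStrongFellerSmearing (ψ (.comp (.restrict (Set.Icc 0 1) (.id ℝ)) a))
      (spectralPOVM (ψ.comp (a.compStarAlgHom' ℝ ℝ))) μ := by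
  set φ : C(Set.Icc (0 : ℝ) 1, ℝ) →⋆ₐ[ℝ] (H →L[ℂ] H) := ψ.comp (a.compStarAlgHom' ℝ ℝ)
  have hop (Δ) (hΔ : MeasurableSet Δ) : φ ⟨_, hμ Δ hΔ⟩ = F.op Δ := by
    obtain ⟨f, hf, hψf⟩ := hF Δ hΔ
    exact hψf ▸ congrArg ψ (ContinuousMap.ext fun y => (hf y).symm)
  have hφ : Continuous φ := hψ.comp a.continuous_precomp
  refine ⟨isSelfAdjoint_starAlgHom_apply ψ _, spectralPOVM_isPVM φ,
    spectralPOVM_isIntegral φ (.restrict _ (.id ℝ)), le_antisymm ?_ ?_, inferInstance, hμ,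
    fun Δ hΔ => hop Δ hΔ ▸ spectralPOVM_isIntegral φ ⟨_, hμ Δ hΔ⟩⟩
  · rw [vonNeumannGenerated_le_iff, Set.singleton_subset_iff]
    exact hmem _
  · refine (vonNeumannGenerated_le_iff _ _).2 ?_
    rintro _ ⟨Δ, hΔ, rfl⟩
    rw [← hop Δ hΔ]
    exact apply_mem_of_apply_id_mem hφ (subset_vonNeumannGenerated _ (Set.mem_singleton _)) _

theorem POVM.IsCommutative.exists_isStrongFellerSmearing
    [MeasurableSpace.CountablyGenerated X] [Nonempty X] (hF : F.IsCommutative)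
    (hFc : F.IsUniformlyContinuous) : ∃ A E μ, F.IsStrongFellerSmearing A E μ := by
  obtain ⟨Y, _, _, _, _, ψ, hψ, hrange⟩ := hF.exists_starAlgHom_range_eq
  have hop (Δ) (hΔ : MeasurableSet Δ) : F.op Δ ∈ Set.range ψ :=
    hrange ▸ ⟨F.op_mem_vonNeumann hΔ, (F.isPositive Δ hΔ).isSelfAdjoint⟩
  obtain ⟨M, hMprob, hM⟩ := POVM.exists_fiber_measures hFc hψ hop
  choose! k hkM hk using hM
  obtain ⟨D, hD, hext⟩ := exists_seq_measurableSet_forall_measure_ext X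
  obtain ⟨a, ha⟩ := exists_continuous_icc_separating fun n => k (D n)
  have haM (y z : Y) (hyz : a y = a z) : M y = M z :=
    hext _ _ fun n => by simpa only [hkM _ (hD n)] using ha y z hyz n
  have hMcont (Δ) (hΔ : MeasurableSet Δ) : Continuous fun y => (M y).real Δ := by
    simpa only [← hkM Δ hΔ] using (k Δ).continuous
  obtain ⟨μ, _, hμ, hμM⟩ := exists_kernel_comp_eq a.continuous hMcont haM
  have hmem (f : C(Y, ℝ)) : ψ f ∈ F.vonNeumann := (hrange.subset ⟨f, rfl⟩).1
  exact ⟨_, _, _, POVM.isStrongFellerSmearing_spectralPOVM hψ.continuous hmem a hμ fun Δ hΔ =>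
    ⟨k Δ, fun y => by rw [hμM, hkM Δ hΔ], hk Δ hΔ⟩⟩

end StrongFellerSmearing

theorem theorem5p5_general {X H : Type*} [MeasurableSpace X] [MeasurableSpace.CountablyGenerated X]
    [Nonempty X] [NormedAddCommGroup H] [InnerProductSpace ℂ H] [CompleteSpace H] (F : POVM X H) :
    (∃ A E μ, F.IsStrongFellerSmearing A E μ) ↔ F.IsCommutative ∧ F.IsUniformlyContinuous :=
  ⟨fun ⟨_, _, _, h⟩ => ⟨h.isCommutative, h.isUniformlyContinuous⟩,
    fun h => h.1.exists_isStrongFellerSmearing h.2⟩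

theorem theorem5p5 {H : Type*} [NormedAddCommGroup H] [InnerProductSpace ℂ H] [CompleteSpace H]
    (F : POVM ℝ H) (hF : F.IsCommutative) :
    F.AdmitsStrongFellerKernel ↔ F.IsUniformlyContinuous := by
  rw [POVM.admitsStrongFellerKernel_iff, theorem5p5_general, and_iff_right hF]
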